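/- **Setting.** Fix $\nu>0$, $v_0\in[0,1]$ and contact angles $\alpha,\alpha_w\in[-\frac\pi2,\frac\pi2]$ (at the grains and at the walls; $\alpha_w=\alpha$ is allowed). For $L,B>0$, $0<R<\frac12$ with $N=\nu L^2\in\mathbb N$, let $\Omega_\nu(L)=([0,L]^2)^N$ carry the uniform probability measure $\mu_\nu$; $\omega=(\xi_1,\dots,\xi_N)\in\Omega_\nu(L)$ is a configuration of closed circular grains $\overline{B_R(\xi_k)}$, which may overlap. Put $\theta=L\max\{1/\sqrt B,R\}$. An *interface* $\Gamma$ for $\omega$ is a non-self-intersecting finite union of oriented arcs $\gamma_0,\dots,\gamma_m$ running through $(0,L)^2$ outside the grains. The arc $\gamma_0$ starts on $\{x_1=0\}$ and $\gamma_m$ ends on $\{x_1=L\}$. Between $\gamma_{j-1}$ and $\gamma_j$ there is a grain, on whose boundary $\gamma_{j-1}$ ends and $\gamma_j$ starts. The region below $\Gamma$ (including grains) is the set of points of $[0,L]^2$ that can be joined to the bottom side without crossing $\Gamma$ or the chords that join, inside each grain of $\Gamma$, its two contact points. Let $v_1L^2$ be its area; its part outside the grains (the liquid) is required to have area $v_0L^2$.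 Each arc has signed curvature $H=B(x_2-v_1L)$ with respect to the normal $\mathbf n$ with $\det(\mathbf t,\mathbf n)=1$, $\mathbf t$ being the unit tangent. At contact points, with $\mathbf N$ the outer normal of the solid, Young's condition holds: $\det(\mathbf N,\mathbf t)=\sin a$ if $\mathbf N\cdot\mathbf t\ge0$ and $\det(\mathbf N,\mathbf t)=\sin(a-\pi)$ if $\mathbf N\cdot\mathbf t<0$, where $a=\alpha$ at grains and $a=\alpha_w$ at walls. **Theorem.** There are constants $D_0,K>0$, depending only on $\nu,v_0,\alpha,\alpha_w$, such that, with $$\delta=\max\Big\{\frac{2D_0}{\sqrt B},2R\Big\}+2Kv_0LR^2,$$ the following hold. 1. If $D\ge D_0$ and an arc of an interface joins grains centred at $\xi_i,\xi_l$ and meets $\{|x_2-v_1L|\ge D/\sqrt B\}$, then $\|\xi_i-\xi_l\|\le \frac{K}{D\sqrt B}+2R$. 2. $\delta\to0$ as $\theta\to0$, uniformly in $L,B,R$ as above. 3. For every $\varepsilon>0$ there is $\theta_\varepsilon>0$ such that for all $L,B,R$ as above with $\theta\le\theta_\varepsilon$ there is a measurable $\Omega_\varepsilon\subset\Omega_\nu(L)$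 with $\mu_\nu(\Omega_\varepsilon)\ge1-\varepsilon$ such that for every $\omega\in\Omega_\varepsilon$: - every interface $\Gamma$ for $\omega$ is contained in $\{|x_2-v_1L|\le\delta\}\cap\{|x_2-v_0L|\le\delta\}$; - if $\alpha_w=0$, there is $h(\omega)$ with $|h(\omega)|\le\delta$ such that every interface $\Gamma$ for $\omega$ is the horizontal line $\{0\le x_1\le L,\ x_2-v_1L=h(\omega)\}$; - if $\alpha_w=0$ and $0<v_0<1$, an interface for $\omega$ exists. -/

import Mathlib

open MeasureTheory Set

noncomputable section

namespace PorousMedium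

/-- The Euclidean plane; `x 0` and `x 1` are the horizontal and the vertical coordinate. -/
abbrev Plane : Type := EuclideanSpace ℝ (Fin 2)

/-- The wedge product `u ∧ v`, i.e. the coefficient of `e₃`, equal to `det (u, v)`. -/
def wedge (u v : Plane) : ℝ := u 0 * v 1 - u 1 * v 0

/-- The unit normal `n` belonging to a unit tangent `t`, with `det (t, n) = 1`.  Along an interface
it points into the air. -/
def normal (t : Plane) : Plane := !₂[-(t 1), t 0]

/-- The closed container `[0, L]²`. -/
def container (L : ℝ) : Set Plane := {x | ∀ i, 0 ≤ x i ∧ x i ≤ L}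

/-- The open container `(0, L)²`. -/
def openContainer (L : ℝ) : Set Plane := {x | ∀ i, 0 < x i ∧ x i < L}

/-- The union of the closed grains of radius `R` centred at the points of `ω`. -/
def grains {N : ℕ} (R : ℝ) (ω : Fin N → Plane) : Set Plane :=
  ⋃ k, Metric.closedBall (ω k) R

/-- The configurations of `N` centres in the container. -/
def configurations (L : ℝ) (N : ℕ) : Set (Fin N → Plane) := {ω | ∀ k, ω k ∈ container L}

/-- The law of `N` independent centres, uniformly distributed in the container:
`L ^ (-2 N) dξ₁ ⋯ dξ_N` on `([0, L]²) ^ N`. -/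
def configMeasure (L : ℝ) (N : ℕ) : Measure (Fin N → Plane) :=
  ENNReal.ofReal ((L ^ (2 * N))⁻¹) • (volume : Measure (Fin N → Plane)).restrict
    (configurations L N)

/-- `θ = L max {1 / √B, R}`. -/
def theta (L B R : ℝ) : ℝ := L * max (1 / Real.sqrt B) R

/-- The bound `max {2 D₀ / √B, 2 R} + 2 K v₀ L R²`. -/
def offsetBound (D₀ K v₀ L B R : ℝ) : ℝ :=
  max (2 * D₀ / Real.sqrt B) (2 * R) + 2 * K * v₀ * L * R ^ 2

/-- Young's condition with contact angle `α` at a contact point at which the outer normal of the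
solid is `ν` and the tangent of the interface is `t`. -/
def YoungCondition (α : ℝ) (ν t : Plane) : Prop :=
  (0 ≤ inner ℝ ν t → wedge ν t = Real.sin α) ∧
  (inner ℝ ν t < 0 → wedge ν t = Real.sin (α - Real.pi))

/-- `γ`, restricted to `[0, ℓ]`, is a curve parametrized by arc length, with tangent `t`, without
self-intersections, whose signed curvature `H` (defined by `t' = H n`) satisfies the capillary
equation `H = B (x₂ - lam)`. -/
structure IsCapillaryCurve (B lam ℓ : ℝ) (γ t : ℝ → Plane) : Prop where
  length_pos : 0 < ℓ
  hasDeriv : ∀ s ∈ Icc 0 ℓ, HasDerivWithinAt γ (t s) (Icc 0 ℓ) s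
  unit_speed : ∀ s ∈ Icc 0 ℓ, ‖t s‖ = 1
  capillary : ∀ s ∈ Icc 0 ℓ,
    HasDerivWithinAt t ((B * (γ s 1 - lam)) • normal (t s)) (Icc 0 ℓ) s
  injOn : InjOn γ (Icc 0 ℓ)

/-- The data of an oriented chain of `m + 1` arcs that meets `m` grains, chosen among `N` grains:
the `j`-th grain of the chain lies between the arcs `j` and `j + 1`; the arc `i` is `curve i`
on `[0, len i]`, with tangent `tangent i`. -/
structure Chain (N : ℕ) where
  m : ℕ
  grain : Fin m → Fin N
  len : Fin (m + 1) → ℝ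
  curve : Fin (m + 1) → ℝ → Plane
  tangent : Fin (m + 1) → ℝ → Plane

namespace Chain

variable {N : ℕ}

/-- The point set of the chain. -/
def carrier (Γ : Chain N) : Set Plane := ⋃ i, Γ.curve i '' Icc 0 (Γ.len i)

/-- The chain made connected: inside each grain of the chain the two contact points
are joined by a chord. -/
def connectedCarrier (Γ : Chain N) : Set Plane :=
  Γ.carrier ∪
    ⋃ j : Fin Γ.m, segment ℝ (Γ.curve j.castSucc (Γ.len j.castSucc)) (Γ.curve j.succ 0)

/-- The part of the container below the chain (including grains): the points that can be joined to
the bottom of the container without crossing the chain. -/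
def below (Γ : Chain N) (L : ℝ) : Set Plane :=
  {x | ∃ y, y 1 = 0 ∧ JoinedIn (container L \ Γ.connectedCarrier) x y}

/-- The volume fraction `v₁` of the part of the container below the chain, including grains. -/
def v₁ (Γ : Chain N) (L : ℝ) : ℝ := (volume (Γ.below L)).toReal / L ^ 2

end Chain

/-- `Γ` is a capillarity-gravity interface for the Bond number `B`, the grain radius `R`, the
liquid volume fraction `v₀`, the contact angle `α` at the grains and `αw` at the walls.  It runs
from the left wall to the right wall, so that the air lies above it. -/
structure IsInterface {N : ℕ} (L B R v₀ α αw : ℝ) (ω : Fin N → Plane) (Γ : Chain N) : Prop where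
  /-- each component solves the capillary equation with reference height `v₁ L` -/
  capillary : ∀ i, IsCapillaryCurve B (Γ.v₁ L * L) (Γ.len i) (Γ.curve i) (Γ.tangent i)
  /-- the components run through the container, outside the grains -/
  inside : ∀ i, ∀ s ∈ Ioo 0 (Γ.len i), Γ.curve i s ∈ openContainer L \ grains R ω
  /-- different components do not meet, except possibly at a common contact point -/
  disjoint : ∀ i i', i < i' → ∀ s ∈ Icc 0 (Γ.len i), ∀ s' ∈ Icc 0 (Γ.len i'),
    Γ.curve i s = Γ.curve i' s' → (i' : ℕ) = i + 1 ∧ s = Γ.len i ∧ s' = 0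
  /-- the first component starts at the left wall -/
  start_wall : Γ.curve 0 0 0 = 0
  young_start : YoungCondition αw !₂[1, 0] (Γ.tangent 0 0)
  /-- the last component ends at the right wall -/
  end_wall : Γ.curve (Fin.last Γ.m) (Γ.len (Fin.last Γ.m)) 0 = L
  young_end : YoungCondition αw !₂[-1, 0] (Γ.tangent (Fin.last Γ.m) (Γ.len (Fin.last Γ.m)))
  /-- each grain of the chain is reached by one component -/
  arrive : ∀ j : Fin Γ.m,
    Γ.curve j.castSucc (Γ.len j.castSucc) ∈ Metric.sphere (ω (Γ.grain j)) R
  young_arrive : ∀ j : Fin Γ.m,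
    YoungCondition α (R⁻¹ • (Γ.curve j.castSucc (Γ.len j.castSucc) - ω (Γ.grain j)))
      (Γ.tangent j.castSucc (Γ.len j.castSucc))
  /-- and left by the next one -/
  leave : ∀ j : Fin Γ.m, Γ.curve j.succ 0 ∈ Metric.sphere (ω (Γ.grain j)) R
  young_leave : ∀ j : Fin Γ.m,
    YoungCondition α (R⁻¹ • (Γ.curve j.succ 0 - ω (Γ.grain j))) (Γ.tangent j.succ 0)
  /-- the liquid (the part below the interface outside the grains) has volume `v₀ L²` -/
  liquid_volume : volume (Γ.below L \ grains R ω) = ENNReal.ofReal (v₀ * L ^ 2)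

end PorousMedium

end

open MeasureTheory Set

noncomputable section

namespace PorousMedium

/-! Write `y` for the height above the level `lam` and `φ` for the inclination angle of a capillary
arc. Then `φ' = B y`, and the energy `E = B y² / 2 + cos φ` is conserved. An arc reaching `|y| ≥ D /
√B` with `D ≥ 4` has `E > 1`, so `y` never vanishes, `φ` is monotone and the curvature is at least
`D √B / 2` in absolute value. Such an arc cannot pass through a full turn between consecutive
multiples of `2π`: there `x` is a function of `φ`, odd up to a constant about the angle `π` modulo
`2π`, and an intermediate value argument gives two symmetric angles with the same point
(`exists_self_intersection`). Hence `φ` varies by less than `4π`, and the length is at most `8π / (D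
√B)` (`length_le`). This is the estimate for neighbouring grains.

Let `d = max {1 / √B, R}`. With probability at least `1 - 27 ν θ`, no centre lies within `9 d` of
the left wall or of the height `v₀ L`. In that case the first arc cannot leave the layer `4 / √B`:
it would end too close to the left wall to reach a grain or the right wall. Inside the layer it
cannot reach a grain either, since `v₁ L` is within `R` of `v₀ L`. So it runs from wall to wall
(`IsInterface.single_component`).

If the walls have contact angle zero, this arc is horizontal at both ends. A nonzero initial height
would give `E > 1` and force a full turn, so the arc is a straight segment (`eq_horizontal`).
Conversely, moving a horizontal line upwards from `v₀ L` until the liquid volume is right produces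
an interface (`exists_isInterface`). -/

/-! ### Self-intersection of capillary curves without inflection. -/

/-- A function on an interval with zero derivative is constant. -/
lemma eq_of_hasDerivWithinAt_zero {f : ℝ → ℝ} {a b : ℝ}
    (hf : ∀ s ∈ Icc a b, HasDerivWithinAt f 0 (Icc a b) s) {s s' : ℝ}
    (hs : s ∈ Icc a b) (hs' : s' ∈ Icc a b) : f s = f s' := by
  have h := (convex_Icc a b).norm_image_sub_le_of_norm_hasDerivWithin_le (C := 0) hf
    (fun x _ => by simp) hs' hs
  rw [zero_mul, norm_le_zero_iff] at h
  linarith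

/-- The horizontal position of a capillary curve as a function of its inclination angle, up to
an additive constant. -/
def abscissa (B E ψ : ℝ) : ℝ :=
  ∫ u in Real.pi..ψ, Real.cos u * (Real.sqrt (2 * B * (E - Real.cos u)))⁻¹

lemma two_mul_sub_cos_pos {B E : ℝ} (hB : 0 < B) (hE : 1 < E) (u : ℝ) :
    0 < 2 * B * (E - Real.cos u) :=
  mul_pos (by positivity) (by linarith [Real.cos_le_one u])

lemma continuous_abscissa_integrand {B E : ℝ} (hB : 0 < B) (hE : 1 < E) :
    Continuous fun u : ℝ => Real.cos u * (Real.sqrt (2 * B * (E - Real.cos u)))⁻¹ := by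
  refine Real.continuous_cos.mul (Continuous.inv₀ (by fun_prop) fun u => ?_)
  exact (Real.sqrt_pos.2 (two_mul_sub_cos_pos hB hE u)).ne'

lemma hasDerivAt_abscissa {B E : ℝ} (hB : 0 < B) (hE : 1 < E) (ψ : ℝ) :
    HasDerivAt (abscissa B E)
      (Real.cos ψ * (Real.sqrt (2 * B * (E - Real.cos ψ)))⁻¹) ψ :=
  ((continuous_abscissa_integrand hB hE).integral_hasStrictDerivAt Real.pi ψ).hasDerivAt

/-- The capillary curve is symmetric about its turning points. -/
lemma abscissa_pi_sub (B E u : ℝ) :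
    abscissa B E (Real.pi - u) = -abscissa B E (Real.pi + u) := by
  -- The substitution `u ↦ 2π - u` preserves the cosine, hence the whole integrand.
  have h := intervalIntegral.integral_comp_sub_left (a := Real.pi) (b := Real.pi + u)
    (fun u : ℝ => Real.cos u * (Real.sqrt (2 * B * (E - Real.cos u)))⁻¹) (2 * Real.pi)
  simp only [Real.cos_two_pi_sub] at h
  rw [abscissa, abscissa, h, intervalIntegral.integral_symm]
  congr 2 <;> ring

/-- Between its turning points, a capillary curve without inflection returns to the vertical axis
through the first of them. -/
lemma exists_abscissa_eq_zero {B E : ℝ} (hB : 0 < B) (hE : 1 < E) :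
    ∃ u ∈ Icc (Real.pi / 2) Real.pi, abscissa B E (Real.pi + u) = 0 := by
  have hcont := continuous_abscissa_integrand hB hE
  have hpi := Real.pi_pos
  -- The cosine is nonpositive on `[π, 3π/2]`.
  have h1 : abscissa B E (Real.pi + Real.pi / 2) ≤ 0 := by
    rw [abscissa, ← intervalIntegral.integral_zero (a := Real.pi) (b := Real.pi + Real.pi / 2)
      (μ := volume) (E := ℝ)]
    refine intervalIntegral.integral_mono_on (by linarith) (hcont.intervalIntegrable _ _)
      (by simp) fun u hu => ?_
    refine mul_nonpos_of_nonpos_of_nonneg ?_ (by positivity)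
    exact Real.cos_nonpos_of_pi_div_two_le_of_le (by linarith [hu.1]) hu.2
  -- The weight increases with `cos u`; replacing it by its value at `cos u = 0` can only decrease
  -- the integrand, and the cosine has integral zero over `[π, 2π]`.
  have h2 : 0 ≤ abscissa B E (Real.pi + Real.pi) := by
    have h0 : ∫ u in Real.pi..(Real.pi + Real.pi), Real.cos u * (Real.sqrt (2 * B * E))⁻¹ = 0 := by
      rw [intervalIntegral.integral_mul_const, integral_cos]
      simp [← two_mul]
    rw [abscissa, ← h0]
    refine intervalIntegral.integral_mono_on (by linarith)
      ((by fun_prop : Continuous fun u : ℝ =>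
        Real.cos u * (Real.sqrt (2 * B * E))⁻¹).intervalIntegrable _ _)
      (hcont.intervalIntegrable _ _) fun u _ => ?_
    have hw := Real.sqrt_pos.2 (two_mul_sub_cos_pos hB hE u)
    have hw0 : 0 < Real.sqrt (2 * B * E) := Real.sqrt_pos.2 (by positivity)
    rcases le_total 0 (Real.cos u) with hc | hc
    · refine mul_le_mul_of_nonneg_left (inv_anti₀ hw (Real.sqrt_le_sqrt ?_)) hc
      nlinarith
    · refine mul_le_mul_of_nonpos_left (inv_anti₀ hw0 (Real.sqrt_le_sqrt ?_)) hc
      nlinarith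
  have hc : ContinuousOn (fun u => abscissa B E (Real.pi + u)) (Icc (Real.pi / 2) Real.pi) :=
    fun u _ => (((hasDerivAt_abscissa hB hE (Real.pi + u)).continuousAt).comp
      (by fun_prop : ContinuousAt (fun u : ℝ => Real.pi + u) u)).continuousWithinAt
  obtain ⟨u, hu, h⟩ := intermediate_value_Icc (by linarith) hc ⟨h1, h2⟩
  exact ⟨u, hu, h⟩

/-- A capillary curve without inflection that makes a full turn, starting at or before a
minimum of its height, intersects itself. -/
lemma exists_self_intersection {B E a b : ℝ} {x y φ : ℝ → ℝ} (hB : 0 < B) (hE : 1 < E)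
    (hab : a ≤ b)
    (hx : ∀ s ∈ Icc a b, HasDerivWithinAt x (Real.cos (φ s)) (Icc a b) s)
    (hφ : ∀ s ∈ Icc a b, HasDerivWithinAt φ (B * y s) (Icc a b) s)
    (hen : ∀ s ∈ Icc a b, B * y s ^ 2 / 2 + Real.cos (φ s) = E)
    (hy : ∀ s ∈ Icc a b, 0 < y s) (k : ℤ) (hka : φ a ≤ k * (2 * Real.pi))
    (hkb : k * (2 * Real.pi) + 2 * Real.pi ≤ φ b) :
    ∃ s ∈ Icc a b, ∃ s' ∈ Icc a b, s ≠ s' ∧ x s = x s' ∧ y s = y s' := by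
  obtain ⟨u, hu, h0⟩ := exists_abscissa_eq_zero hB hE
  have hpi := Real.pi_pos
  have hφc : ContinuousOn φ (Icc a b) := fun s hs => (hφ s hs).continuousWithinAt
  obtain ⟨s, hs, hsφ⟩ := intermediate_value_Icc hab hφc
    (show k * (2 * Real.pi) + (Real.pi - u) ∈ Icc (φ a) (φ b) from
      ⟨by linarith [hu.2], by linarith [hu.1]⟩)
  obtain ⟨s', hs', hsφ'⟩ := intermediate_value_Icc hab hφc
    (show k * (2 * Real.pi) + (Real.pi + u) ∈ Icc (φ a) (φ b) from
      ⟨by linarith [hu.1], by linarith [hu.2]⟩)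
  have hcos : Real.cos (φ s) = Real.cos (φ s') := by
    rw [hsφ, hsφ', add_comm, Real.cos_add_int_mul_two_pi, add_comm, Real.cos_add_int_mul_two_pi,
      Real.cos_pi_sub, Real.cos_add, Real.cos_pi, Real.sin_pi]
    ring
  refine ⟨s, hs, s', hs', ?_, ?_, ?_⟩
  · rintro rfl
    linarith [hu.1]
  -- Since `y > 0`, the energy gives `B y = √(2 B (E - cos φ))`, so `dx/dφ = cos φ / (B y)` is the
  -- integrand of `abscissa`.
  · have hd : ∀ r ∈ Icc a b, HasDerivWithinAt
        (fun r => x r - abscissa B E (φ r - k * (2 * Real.pi))) 0 (Icc a b) r := by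
      intro r hr
      have h1 := (hasDerivAt_abscissa hB hE (φ r - k * (2 * Real.pi))).comp_hasDerivWithinAt r
        ((hφ r hr).sub_const (k * (2 * Real.pi)))
      refine ((hx r hr).sub h1).congr_deriv ?_
      have hroot : Real.sqrt (2 * B * (E - Real.cos (φ r))) = B * y r := by
        rw [← hen r hr, show 2 * B * (B * y r ^ 2 / 2 + Real.cos (φ r) - Real.cos (φ r))
          = (B * y r) ^ 2 by ring]
        exact Real.sqrt_sq (mul_pos hB (hy r hr)).le
      have hne : B * y r ≠ 0 := (mul_pos hB (hy r hr)).ne'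
      rw [Real.cos_sub_int_mul_two_pi, hroot]
      rw [mul_assoc, inv_mul_cancel₀ hne, mul_one, sub_self]
    have h := eq_of_hasDerivWithinAt_zero hd hs hs'
    simp only [hsφ, hsφ', add_sub_cancel_left, abscissa_pi_sub, h0] at h
    linarith
  · have h1 := hen s hs
    have h2 := hen s' hs'
    rw [hcos] at h1
    have h3 : y s ^ 2 = y s' ^ 2 := mul_left_cancel₀ hB.ne' (by linarith)
    exact (pow_left_inj₀ (hy s hs).le (hy s' hs').le two_ne_zero).1 h3

/-- A continuous function without zeros on an interval has constant sign there. -/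
lemma forall_pos_or_forall_neg {f : ℝ → ℝ} {a b : ℝ} (hf : ContinuousOn f (Icc a b))
    (h0 : ∀ s ∈ Icc a b, f s ≠ 0) :
    (∀ s ∈ Icc a b, 0 < f s) ∨ ∀ s ∈ Icc a b, f s < 0 := by
  by_contra! h
  obtain ⟨⟨s, hs, hs0⟩, s', hs', hs0'⟩ := h
  obtain ⟨r, hr, hr0⟩ := isPreconnected_Icc.intermediate_value hs hs' hf ⟨hs0, hs0'⟩
  exact h0 r hr hr0

/-- The mean value inequality for one-sided derivatives at the end points. -/
lemma mul_sub_le_of_hasDerivWithinAt_ge {f f' : ℝ → ℝ} {a b c : ℝ} (hab : a ≤ b)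
    (hf : ∀ s ∈ Icc a b, HasDerivWithinAt f (f' s) (Icc a b) s) (hc : ∀ s ∈ Icc a b, c ≤ f' s) :
    c * (b - a) ≤ f b - f a := by
  refine (convex_Icc a b).mul_sub_le_image_sub_of_le_deriv
    (fun s hs => (hf s hs).continuousWithinAt) (fun s hs => ?_) (fun s hs => ?_) a
    (left_mem_Icc.2 hab) b (right_mem_Icc.2 hab) hab
  · rw [interior_Icc] at hs
    exact ((hf s (Ioo_subset_Icc_self hs)).hasDerivAt
      (Icc_mem_nhds hs.1 hs.2)).differentiableAt.differentiableWithinAt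
  · rw [interior_Icc] at hs
    rw [((hf s (Ioo_subset_Icc_self hs)).hasDerivAt (Icc_mem_nhds hs.1 hs.2)).deriv]
    exact hc s (Ioo_subset_Icc_self hs)

/-! ### Energy, inclination angle and length of capillary curves. -/

namespace IsCapillaryCurve

variable {B lam ℓ : ℝ} {γ t : ℝ → Plane}

lemma hasDeriv_apply (h : IsCapillaryCurve B lam ℓ γ t) (i : Fin 2) {s : ℝ} (hs : s ∈ Icc 0 ℓ) :
    HasDerivWithinAt (fun s => γ s i) (t s i) (Icc 0 ℓ) s :=
  (EuclideanSpace.proj (𝕜 := ℝ) i).hasFDerivAt.comp_hasDerivWithinAt s (h.hasDeriv s hs)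

lemma hasDeriv_height (h : IsCapillaryCurve B lam ℓ γ t) {s : ℝ} (hs : s ∈ Icc 0 ℓ) :
    HasDerivWithinAt (fun s => γ s 1 - lam) (t s 1) (Icc 0 ℓ) s :=
  (h.hasDeriv_apply 1 hs).sub_const lam

lemma continuousOn_height (h : IsCapillaryCurve B lam ℓ γ t) :
    ContinuousOn (fun s => γ s 1 - lam) (Icc 0 ℓ) :=
  fun _ hs => (h.hasDeriv_height hs).continuousWithinAt

lemma hasDeriv_tangent_zero (h : IsCapillaryCurve B lam ℓ γ t) {s : ℝ} (hs : s ∈ Icc 0 ℓ) :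
    HasDerivWithinAt (fun s => t s 0) (B * (γ s 1 - lam) * -(t s 1)) (Icc 0 ℓ) s := by
  have := (EuclideanSpace.proj (𝕜 := ℝ) (0 : Fin 2)).hasFDerivAt.comp_hasDerivWithinAt s
    (h.capillary s hs)
  exact this.congr_deriv (by simp [normal])

lemma hasDeriv_tangent_one (h : IsCapillaryCurve B lam ℓ γ t) {s : ℝ} (hs : s ∈ Icc 0 ℓ) :
    HasDerivWithinAt (fun s => t s 1) (B * (γ s 1 - lam) * t s 0) (Icc 0 ℓ) s := by
  have := (EuclideanSpace.proj (𝕜 := ℝ) (1 : Fin 2)).hasFDerivAt.comp_hasDerivWithinAt s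
    (h.capillary s hs)
  exact this.congr_deriv (by simp [normal])

lemma tangent_sq (h : IsCapillaryCurve B lam ℓ γ t) {s : ℝ} (hs : s ∈ Icc 0 ℓ) :
    t s 0 ^ 2 + t s 1 ^ 2 = 1 := by
  have h1 := h.unit_speed s hs
  rw [EuclideanSpace.norm_eq, Real.sqrt_eq_one, Fin.sum_univ_two] at h1
  simpa using h1

lemma abs_tangent_le (h : IsCapillaryCurve B lam ℓ γ t) {s : ℝ} (hs : s ∈ Icc 0 ℓ) :
    |t s 0| ≤ 1 := by
  rw [← sq_le_one_iff_abs_le_one]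
  nlinarith [h.tangent_sq hs, sq_nonneg (t s 1)]

lemma zero_mem (h : IsCapillaryCurve B lam ℓ γ t) : (0 : ℝ) ∈ Icc 0 ℓ := ⟨le_rfl, h.length_pos.le⟩

lemma length_mem (h : IsCapillaryCurve B lam ℓ γ t) : ℓ ∈ Icc 0 ℓ := ⟨h.length_pos.le, le_rfl⟩

/-- The first integral of the capillary equation. -/
lemma energy_eq (h : IsCapillaryCurve B lam ℓ γ t) {s s' : ℝ} (hs : s ∈ Icc 0 ℓ)
    (hs' : s' ∈ Icc 0 ℓ) :
    B * (γ s 1 - lam) ^ 2 / 2 + t s 0 = B * (γ s' 1 - lam) ^ 2 / 2 + t s' 0 := by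
  refine eq_of_hasDerivWithinAt_zero
    (f := fun s => B * (γ s 1 - lam) ^ 2 / 2 + t s 0) (fun r hr => ?_) hs hs'
  refine (((((h.hasDeriv_height hr).pow 2).const_mul B).div_const 2).add
    (h.hasDeriv_tangent_zero hr)).congr_deriv ?_
  simp only [Nat.cast_ofNat, Nat.add_one_sub_one, pow_one]
  ring

/-- A capillary curve has an inclination angle. -/
lemma exists_angle (h : IsCapillaryCurve B lam ℓ γ t) {φ₀ : ℝ} (h0 : t 0 0 = Real.cos φ₀)
    (h1 : t 0 1 = Real.sin φ₀) :
    ∃ φ : ℝ → ℝ, φ 0 = φ₀ ∧ ∀ s ∈ Icc 0 ℓ,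
      HasDerivWithinAt φ (B * (γ s 1 - lam)) (Icc 0 ℓ) s ∧
      t s 0 = Real.cos (φ s) ∧ t s 1 = Real.sin (φ s) := by
  -- The curvature is extended constantly beyond the end points, so that its primitive is
  -- differentiable everywhere.
  have hc : Continuous (IccExtend h.length_pos.le
      ((Icc 0 ℓ).domRestrict fun s => B * (γ s 1 - lam))) :=
    (continuousOn_iff_continuous_domRestrict.1
      (continuousOn_const.mul h.continuousOn_height)).Icc_extend'
  set H := IccExtend h.length_pos.le ((Icc 0 ℓ).domRestrict fun s => B * (γ s 1 - lam)) with hH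
  set φ : ℝ → ℝ := fun s => φ₀ + ∫ r in (0 : ℝ)..s, H r with hφdef
  have hφ0 : φ 0 = φ₀ := by simp [hφdef]
  have hφ : ∀ s ∈ Icc 0 ℓ, HasDerivWithinAt φ (B * (γ s 1 - lam)) (Icc 0 ℓ) s := by
    intro s hs
    have h2 := ((hc.integral_hasStrictDerivAt 0 s).hasDerivAt.const_add φ₀).hasDerivWithinAt
      (s := Icc 0 ℓ)
    refine h2.congr_deriv ?_
    rw [hH, IccExtend_of_mem _ _ hs]
    rfl
  refine ⟨φ, hφ0, fun s hs => ⟨hφ s hs, ?_⟩⟩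
  -- The tangent rotated back by `φ` has constant components; `hu` and `hw` are the two of them.
  have hu : ∀ r ∈ Icc 0 ℓ, HasDerivWithinAt
      (fun r => t r 0 * Real.cos (φ r) + t r 1 * Real.sin (φ r)) 0 (Icc 0 ℓ) r := fun r hr =>
    (((h.hasDeriv_tangent_zero hr).mul (hφ r hr).cos).add
      ((h.hasDeriv_tangent_one hr).mul (hφ r hr).sin)).congr_deriv (by ring)
  have hw : ∀ r ∈ Icc 0 ℓ, HasDerivWithinAt
      (fun r => t r 1 * Real.cos (φ r) - t r 0 * Real.sin (φ r)) 0 (Icc 0 ℓ) r := fun r hr =>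
    (((h.hasDeriv_tangent_one hr).mul (hφ r hr).cos).sub
      ((h.hasDeriv_tangent_zero hr).mul (hφ r hr).sin)).congr_deriv (by ring)
  have hu' := eq_of_hasDerivWithinAt_zero hu hs h.zero_mem
  have hw' := eq_of_hasDerivWithinAt_zero hw hs h.zero_mem
  simp only [hφ0, h0, h1] at hu' hw'
  have hcs := Real.cos_sq_add_sin_sq (φ s)
  have hcs0 := Real.cos_sq_add_sin_sq φ₀
  constructor
  · linear_combination Real.cos (φ s) * hu' - Real.sin (φ s) * hw' - t s 0 * hcs
      + Real.cos (φ s) * hcs0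
  · linear_combination Real.sin (φ s) * hu' + Real.cos (φ s) * hw' - t s 1 * hcs
      + Real.sin (φ s) * hcs0

lemma exists_initial_angle (h : IsCapillaryCurve B lam ℓ γ t) :
    ∃ φ₀ : ℝ, t 0 0 = Real.cos φ₀ ∧ t 0 1 = Real.sin φ₀ := by
  have hsq := h.tangent_sq h.zero_mem
  set z : ℂ := ⟨t 0 0, t 0 1⟩ with hz
  have hz1 : ‖z‖ = 1 := by
    rw [Complex.norm_def, Real.sqrt_eq_one, Complex.normSq_mk]
    linarith
  refine ⟨z.arg, ?_, ?_⟩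
  · have := Complex.norm_mul_cos_arg z
    rw [hz1, one_mul] at this
    exact this.symm
  · have := Complex.norm_mul_sin_arg z
    rw [hz1, one_mul] at this
    exact this.symm

/-- A capillary curve whose energy exceeds that of the separatrix has no inflection. -/
lemma height_ne_zero (h : IsCapillaryCurve B lam ℓ γ t)
    (hE : 1 < B * (γ 0 1 - lam) ^ 2 / 2 + t 0 0) {s : ℝ} (hs : s ∈ Icc 0 ℓ) :
    γ s 1 - lam ≠ 0 := by
  intro h0
  have h1 := h.energy_eq hs h.zero_mem
  rw [h0] at h1
  linarith [(abs_le.1 (h.abs_tangent_le hs)).2]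

/-- A capillary curve without inflection does not make a full turn. -/
lemma not_full_turn (h : IsCapillaryCurve B lam ℓ γ t) (hB : 0 < B)
    (hE : 1 < B * (γ 0 1 - lam) ^ 2 / 2 + t 0 0) {φ : ℝ → ℝ}
    (hφ : ∀ s ∈ Icc 0 ℓ, HasDerivWithinAt φ (B * (γ s 1 - lam)) (Icc 0 ℓ) s ∧
      t s 0 = Real.cos (φ s) ∧ t s 1 = Real.sin (φ s)) (k : ℤ) :
    ((∀ s ∈ Icc 0 ℓ, 0 < γ s 1 - lam) → φ 0 ≤ k * (2 * Real.pi) →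
      φ ℓ < k * (2 * Real.pi) + 2 * Real.pi) ∧
    ((∀ s ∈ Icc 0 ℓ, γ s 1 - lam < 0) → -φ 0 ≤ k * (2 * Real.pi) →
      -φ ℓ < k * (2 * Real.pi) + 2 * Real.pi) := by
  have hx : ∀ s ∈ Icc 0 ℓ, HasDerivWithinAt (fun s => γ s 0) (Real.cos (φ s)) (Icc 0 ℓ) s :=
    fun s hs => (hφ s hs).2.1 ▸ h.hasDeriv_apply 0 hs
  have hinj : ∀ s ∈ Icc 0 ℓ, ∀ s' ∈ Icc 0 ℓ, s ≠ s' → γ s 0 = γ s' 0 →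
      γ s 1 - lam ≠ γ s' 1 - lam := by
    intro s hs s' hs' hne h0 h1
    refine hne (h.injOn hs hs' ?_)
    ext i
    fin_cases i
    · exact h0
    · exact sub_left_inj.1 h1
  have hen : ∀ s ∈ Icc 0 ℓ, B * (γ s 1 - lam) ^ 2 / 2 + Real.cos (φ s)
      = B * (γ 0 1 - lam) ^ 2 / 2 + t 0 0 :=
    fun s hs => (hφ s hs).2.1 ▸ h.energy_eq hs h.zero_mem
  constructor
  · intro hy h0
    by_contra! hl
    obtain ⟨s, hs, s', hs', hne, h1, h2⟩ := exists_self_intersection hB hE h.length_pos.le hx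
      (fun s hs => (hφ s hs).1) hen hy k h0 hl
    exact hinj s hs s' hs' hne h1 h2
  · intro hy h0
    by_contra! hl
    -- Reflection in the line `y = 0` changes the signs of `φ` and `y` and reduces this to the case
    -- of positive height.
    obtain ⟨s, hs, s', hs', hne, h1, h2⟩ := exists_self_intersection
      (φ := fun s => -φ s) (y := fun s => -(γ s 1 - lam)) hB hE h.length_pos.le
      (fun s hs => by simpa only [Real.cos_neg] using hx s hs)
      (fun s hs => (hφ s hs).1.neg.congr_deriv (by ring))
      (fun s hs => by simpa only [Real.cos_neg, neg_sq] using hen s hs)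
      (fun s hs => neg_pos.2 (hy s hs)) k h0 hl
    exact hinj s hs s' hs' hne h1 (neg_injective h2)

/-- The inclination angle of a capillary curve without inflection changes by less than two
full turns. -/
lemma abs_angle_sub_lt (h : IsCapillaryCurve B lam ℓ γ t) (hB : 0 < B)
    (hE : 1 < B * (γ 0 1 - lam) ^ 2 / 2 + t 0 0) {φ : ℝ → ℝ}
    (hφ : ∀ s ∈ Icc 0 ℓ, HasDerivWithinAt φ (B * (γ s 1 - lam)) (Icc 0 ℓ) s ∧
      t s 0 = Real.cos (φ s) ∧ t s 1 = Real.sin (φ s)) :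
    ((∀ s ∈ Icc 0 ℓ, 0 < γ s 1 - lam) → φ ℓ - φ 0 < 4 * Real.pi) ∧
    ((∀ s ∈ Icc 0 ℓ, γ s 1 - lam < 0) → φ 0 - φ ℓ < 4 * Real.pi) := by
  -- Less than `2π` is needed to reach the next multiple of `2π`, and less than `2π` remains after
  -- it.
  have key : ∀ a : ℝ, ∃ k : ℤ, a ≤ k * (2 * Real.pi) ∧ k * (2 * Real.pi) < a + 2 * Real.pi := by
    intro a
    refine ⟨⌈a / (2 * Real.pi)⌉, ?_, ?_⟩
    · rw [← div_le_iff₀ Real.two_pi_pos]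
      exact Int.le_ceil _
    · have h1 := mul_lt_mul_of_pos_right (Int.ceil_lt_add_one (a / (2 * Real.pi)))
        Real.two_pi_pos
      rwa [add_mul, one_mul, div_mul_cancel₀ _ Real.two_pi_pos.ne'] at h1
  constructor
  · intro hy
    obtain ⟨k, hk, hk'⟩ := key (φ 0)
    linarith [(h.not_full_turn hB hE hφ k).1 hy hk]
  · intro hy
    obtain ⟨k, hk, hk'⟩ := key (-φ 0)
    linarith [(h.not_full_turn hB hE hφ k).2 hy hk]

/-- A capillary curve that leaves the layer of height `D / √B` is short. -/
lemma length_le (h : IsCapillaryCurve B lam ℓ γ t) (hB : 0 < B) {D s₀ : ℝ} (hD : 4 ≤ D)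
    (hs₀ : s₀ ∈ Icc 0 ℓ) (hDs : D / Real.sqrt B ≤ |γ s₀ 1 - lam|) :
    ℓ ≤ 8 * Real.pi / (D * Real.sqrt B) := by
  have hb := Real.sqrt_pos.2 hB
  have hbb : Real.sqrt B ^ 2 = B := Real.sq_sqrt hB.le
  have hD2 : D ^ 2 ≤ B * (γ s₀ 1 - lam) ^ 2 := by
    rw [div_le_iff₀ hb] at hDs
    rw [← sq_abs (γ s₀ 1 - lam), mul_comm, ← hbb, ← mul_pow]
    exact pow_le_pow_left₀ (by linarith) hDs 2
  -- The horizontal tangent component lies in `[-1, 1]`, so by conservation of energy `B y²` varies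
  -- by at most `4`.
  have hall : ∀ s ∈ Icc 0 ℓ, D ^ 2 - 4 ≤ B * (γ s 1 - lam) ^ 2 := by
    intro s hs
    have h1 := h.energy_eq hs hs₀
    linarith [(abs_le.1 (h.abs_tangent_le hs)).2, (abs_le.1 (h.abs_tangent_le hs₀)).1]
  have hE : 1 < B * (γ 0 1 - lam) ^ 2 / 2 + t 0 0 := by
    rw [h.energy_eq h.zero_mem hs₀]
    nlinarith [(abs_le.1 (h.abs_tangent_le hs₀)).1]
  -- Here `D ≥ 4` gives `D² - 4 ≥ D² / 4`.
  have hH : ∀ s ∈ Icc 0 ℓ, D * Real.sqrt B / 2 ≤ |B * (γ s 1 - lam)| := by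
    intro s hs
    refine abs_le_of_sq_le_sq' ?_ (abs_nonneg _) |>.2
    have h1 := mul_le_mul_of_nonneg_left (hall s hs) hB.le
    rw [sq_abs, div_pow, mul_pow, hbb]
    nlinarith [mul_nonneg hB.le (show (0 : ℝ) ≤ D ^ 2 - 16 by nlinarith)]
  obtain ⟨φ₀, hφ0, hφ1⟩ := h.exists_initial_angle
  obtain ⟨φ, -, hφ⟩ := h.exists_angle hφ0 hφ1
  have hturn := h.abs_angle_sub_lt hB hE hφ
  have hpos : 0 < D * Real.sqrt B := by positivity
  have hfin : D * Real.sqrt B / 2 * (ℓ - 0) ≤ 4 * Real.pi := by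
    rcases forall_pos_or_forall_neg h.continuousOn_height (fun s hs => h.height_ne_zero hE hs)
      with hy | hy
    · have := mul_sub_le_of_hasDerivWithinAt_ge h.length_pos.le (fun s hs => (hφ s hs).1)
        (c := D * Real.sqrt B / 2) fun s hs => by
          have := hH s hs
          rwa [abs_of_pos (mul_pos hB (hy s hs))] at this
      linarith [hturn.1 hy]
    · have := mul_sub_le_of_hasDerivWithinAt_ge h.length_pos.le (fun s hs => (hφ s hs).1.neg)
        (c := D * Real.sqrt B / 2) fun s hs => by
          have := hH s hs
          rwa [abs_of_neg (mul_neg_of_pos_of_neg hB (hy s hs))] at this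
      simp only [Pi.neg_apply] at this
      linarith [hturn.2 hy]
  rw [le_div_iff₀ hpos]
  linarith

/-- The end points of a capillary curve are at most its length apart. -/
lemma norm_sub_le (h : IsCapillaryCurve B lam ℓ γ t) : ‖γ ℓ - γ 0‖ ≤ ℓ := by
  have := (convex_Icc 0 ℓ).norm_image_sub_le_of_norm_hasDerivWithin_le (C := 1) h.hasDeriv
    (fun s hs => (h.unit_speed s hs).le) h.zero_mem h.length_mem
  rwa [one_mul, sub_zero, Real.norm_of_nonneg h.length_pos.le] at this

/-- A capillary curve that is horizontal at both ends, and points to the right there, is a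
horizontal segment at the reference height. -/
lemma eq_horizontal (h : IsCapillaryCurve B lam ℓ γ t) (hB : 0 < B) (h0 : t 0 0 = 1)
    (hl : t ℓ 0 = 1) {s : ℝ} (hs : s ∈ Icc 0 ℓ) : γ s 1 = lam ∧ γ s 0 = γ 0 0 + s := by
  have ht1 : t 0 1 = 0 := by
    have := h.tangent_sq h.zero_mem
    rw [h0] at this
    exact pow_eq_zero_iff two_ne_zero |>.1 (by linarith)
  have hy0 : γ 0 1 - lam = 0 := by
    by_contra hne
    have hE : 1 < B * (γ 0 1 - lam) ^ 2 / 2 + t 0 0 := by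
      rw [h0]
      have : 0 < B * (γ 0 1 - lam) ^ 2 := by positivity
      linarith
    obtain ⟨φ, hφ0, hφ⟩ := h.exists_angle (φ₀ := 0) (by simpa using h0) (by simpa using ht1)
    have hcos := (hφ ℓ h.length_mem).2.1
    rw [hl] at hcos
    -- The final angle is a multiple of `2π`, nonzero by strict monotonicity but smaller than `2π`
    -- in absolute value.
    obtain ⟨k, hk⟩ := (Real.cos_eq_one_iff _).1 hcos.symm
    have hturn := h.not_full_turn hB hE hφ 0
    simp only [hφ0, Int.cast_zero, zero_mul, neg_zero, le_refl, forall_const, zero_add] at hturn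
    have hpi := Real.two_pi_pos
    rcases forall_pos_or_forall_neg h.continuousOn_height (fun s hs => h.height_ne_zero hE hs)
      with hy | hy
    · have hmono : StrictMonoOn φ (Icc 0 ℓ) := by
        refine strictMonoOn_of_hasDerivWithinAt_pos (f' := fun s => B * (γ s 1 - lam))
          (convex_Icc 0 ℓ)
          (fun s hs => (hφ s hs).1.continuousWithinAt) (fun s hs => ?_) (fun s hs => ?_)
        · exact (hφ s (interior_subset hs)).1.mono interior_subset
        · exact mul_pos hB (hy s (interior_subset hs))
      have h1 := hmono h.zero_mem h.length_mem h.length_pos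
      have h2 := hturn.1 hy
      rw [← hk] at h1 h2
      rw [hφ0] at h1
      have hk1 : (0 : ℝ) < k := pos_of_mul_pos_left h1 hpi.le
      have hk2 : (k : ℝ) < 1 := by nlinarith
      norm_cast at hk1 hk2
      omega
    · have hmono : StrictAntiOn φ (Icc 0 ℓ) := by
        refine strictAntiOn_of_hasDerivWithinAt_neg (f' := fun s => B * (γ s 1 - lam))
          (convex_Icc 0 ℓ)
          (fun s hs => (hφ s hs).1.continuousWithinAt) (fun s hs => ?_) (fun s hs => ?_)
        · exact (hφ s (interior_subset hs)).1.mono interior_subset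
        · exact mul_neg_of_pos_of_neg hB (hy s (interior_subset hs))
      have h1 := hmono h.zero_mem h.length_mem h.length_pos
      have h2 := hturn.2 hy
      rw [← hk] at h1 h2
      rw [hφ0] at h1
      have hk1 : (k : ℝ) < 0 := by nlinarith
      have hk2 : (-1 : ℝ) < k := by nlinarith
      norm_cast at hk1 hk2
      omega
  have hen : ∀ r ∈ Icc 0 ℓ, B * (γ r 1 - lam) ^ 2 = 2 * (1 - t r 0) := by
    intro r hr
    have := h.energy_eq hr h.zero_mem
    rw [hy0, h0] at this
    linarith
  have hy : ∀ r ∈ Icc 0 ℓ, γ r 1 - lam = 0 := by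
    -- Grönwall: on the separatrix `E = 1`, `y'² = 1 - (t 0)² ≤ 2 (1 - t 0) = B y²`.
    refine eq_zero_of_abs_deriv_le_mul_abs_self_of_eq_zero_right (K := Real.sqrt B)
      (f' := fun r => t r 1) h.continuousOn_height (fun r hr => ?_) hy0 (fun r hr => ?_)
    · exact (h.hasDeriv_height (Ico_subset_Icc_self hr)).mono_of_mem_nhdsWithin
        (Icc_mem_nhdsGE_of_mem hr)
    · have hr' := Ico_subset_Icc_self hr
      rw [Real.norm_eq_abs, Real.norm_eq_abs, ← abs_of_pos (Real.sqrt_pos.2 hB), ← abs_mul,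
        ← sq_le_sq, mul_pow, Real.sq_sqrt hB.le, hen r hr']
      nlinarith [h.tangent_sq hr', sq_nonneg (1 - t r 0)]
  refine ⟨sub_eq_zero.1 (hy s hs), ?_⟩
  have hx : ∀ r ∈ Icc 0 ℓ, HasDerivWithinAt (fun r => γ r 0 - r) 0 (Icc 0 ℓ) r := by
    intro r hr
    refine ((h.hasDeriv_apply 0 hr).sub (hasDerivWithinAt_id r _)).congr_deriv ?_
    have := hen r hr
    rw [hy r hr] at this
    linarith
  have := eq_of_hasDerivWithinAt_zero hx hs h.zero_mem
  simp only [sub_zero] at this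
  linarith

end IsCapillaryCurve

/-! ### Areas, volume fractions and the probability of good configurations. -/

/-- The axis-parallel rectangle `I × J` in the plane. -/
def rectangle (I J : Set ℝ) : Set Plane := {x | x 0 ∈ I ∧ x 1 ∈ J}

lemma measurableSet_rectangle {I J : Set ℝ} (hI : MeasurableSet I) (hJ : MeasurableSet J) :
    MeasurableSet (rectangle I J) :=
  ((by fun_prop : Measurable fun x : Plane => x 0) hI).inter
    ((by fun_prop : Measurable fun x : Plane => x 1) hJ)

lemma volume_rectangle (I J : Set ℝ) : volume (rectangle I J) = volume I * volume J := by
  have h := (EuclideanSpace.volume_preserving_symm_measurableEquiv_toLp (Fin 2)).measure_preimage_equiv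
    (Set.pi univ ![I, J])
  rw [volume_pi_pi, Fin.prod_univ_two] at h
  simp only [Matrix.cons_val_zero, Matrix.cons_val_one] at h
  rw [← h]
  congr 1
  ext x
  simp [rectangle, Fin.forall_fin_two]

lemma container_eq_rectangle (L : ℝ) : container L = rectangle (Icc 0 L) (Icc 0 L) := by
  ext x
  simp [container, rectangle, Fin.forall_fin_two]

lemma measurableSet_container (L : ℝ) : MeasurableSet (container L) :=
  container_eq_rectangle L ▸ measurableSet_rectangle measurableSet_Icc measurableSet_Icc

lemma volume_container {L : ℝ} (hL : 0 ≤ L) : volume (container L) = ENNReal.ofReal (L ^ 2) := by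
  rw [container_eq_rectangle, volume_rectangle, Real.volume_Icc, sub_zero,
    ← ENNReal.ofReal_mul hL, sq]

lemma volume_grains_le {N : ℕ} {R : ℝ} (hR : 0 ≤ R) (ω : Fin N → Plane) :
    volume (grains R ω) ≤ ENNReal.ofReal (N * (Real.pi * R ^ 2)) := by
  refine (measure_iUnion_le _).trans_eq ?_
  simp only [EuclideanSpace.volume_closedBall_fin_two, tsum_fintype, Finset.sum_const,
    Finset.card_univ, Fintype.card_fin, nsmul_eq_mul]
  rw [ENNReal.ofReal_mul (Nat.cast_nonneg N), ENNReal.ofReal_natCast,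
    ENNReal.ofReal_mul Real.pi_pos.le, ENNReal.ofReal_pow hR, mul_comm (ENNReal.ofReal Real.pi)]

/-- The grains of the chain below the interface account for the difference between the volume
fractions `v₁` and `v₀`. -/
lemma abs_v₁_sub_le {N : ℕ} {L B R v₀ α αw : ℝ} {ω : Fin N → Plane} {Γ : Chain N} (hL : 0 < L)
    (hR : 0 ≤ R) (hv₀ : 0 ≤ v₀) (hΓ : IsInterface L B R v₀ α αw ω Γ) :
    |Γ.v₁ L * L - v₀ * L| * L ≤ N * (Real.pi * R ^ 2) := by
  have hsub : Γ.below L ⊆ container L := fun x ⟨_, _, hj⟩ => hj.source_mem.1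
  have hfin : volume (Γ.below L) ≠ ⊤ :=
    ne_top_of_le_ne_top (by rw [volume_container hL.le]; exact ENNReal.ofReal_ne_top)
      (measure_mono hsub)
  have hN : (0 : ℝ) ≤ N * (Real.pi * R ^ 2) := by positivity
  have hv : (0 : ℝ) ≤ v₀ * L ^ 2 := by positivity
  have h1 : v₀ * L ^ 2 ≤ (volume (Γ.below L)).toReal := by
    rw [← ENNReal.ofReal_le_iff_le_toReal hfin, ← hΓ.liquid_volume]
    exact measure_mono sdiff_subset
  have h2 : (volume (Γ.below L)).toReal ≤ v₀ * L ^ 2 + N * (Real.pi * R ^ 2) := by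
    refine ENNReal.toReal_le_of_le_ofReal (by positivity) ?_
    rw [ENNReal.ofReal_add hv hN, ← hΓ.liquid_volume]
    -- Monotonicity and subadditivity suffice, so `below` need not be measurable.
    refine (measure_mono (t := (Γ.below L \ grains R ω) ∪ grains R ω) ?_).trans
      ((measure_union_le _ _).trans (by gcongr; exact volume_grains_le hR ω))
    rw [sdiff_union_self]
    exact subset_union_left
  have h3 : (Γ.v₁ L * L - v₀ * L) * L = (volume (Γ.below L)).toReal - v₀ * L ^ 2 := by
    rw [Chain.v₁]
    field_simp
  rw [← abs_of_pos hL, ← abs_mul, abs_of_pos hL, h3, abs_of_nonneg (by linarith)]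
  linarith

/-- The admissible positions of a grain: away from the left wall and from the height `c`. -/
def goodPositions (L c a : ℝ) : Set Plane := {x | x ∈ container L ∧ a ≤ x 0 ∧ a ≤ |x 1 - c|}

/-- The configurations whose grains all have admissible positions. -/
def goodConfigurations (L c a : ℝ) (N : ℕ) : Set (Fin N → Plane) :=
  {ω | ∀ k, ω k ∈ goodPositions L c a}

lemma goodConfigurations_eq_pi (L c a : ℝ) (N : ℕ) :
    goodConfigurations L c a N = Set.pi univ fun _ => goodPositions L c a := by
  ext ω
  simp [goodConfigurations]

lemma goodConfigurations_subset (L c a : ℝ) (N : ℕ) :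
    goodConfigurations L c a N ⊆ configurations L N := fun _ h k => (h k).1

lemma measurableSet_goodPositions (L c a : ℝ) : MeasurableSet (goodPositions L c a) :=
  (measurableSet_container L).inter
    ((measurableSet_le measurable_const (by fun_prop : Measurable fun x : Plane => x 0)).inter
      (measurableSet_le measurable_const (by fun_prop : Measurable fun x : Plane => |x 1 - c|)))

lemma measurableSet_goodConfigurations (L c a : ℝ) (N : ℕ) :
    MeasurableSet (goodConfigurations L c a N) := by
  rw [goodConfigurations_eq_pi]
  exact MeasurableSet.univ_pi fun _ => measurableSet_goodPositions L c a

/-- The excluded positions are covered by a vertical strip of width `a` and a horizontal one of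
width `2 a`, of total area `3 a L`. -/
lemma le_volume_goodPositions {L a : ℝ} (c : ℝ) (hL : 0 < L) (ha : 0 ≤ a) :
    ENNReal.ofReal (L ^ 2 * (1 - 3 * a / L)) ≤ volume (goodPositions L c a) := by
  have hcover : container L ⊆ goodPositions L c a ∪
      (rectangle (Icc 0 a) (Icc 0 L) ∪ rectangle (Icc 0 L) (Icc (c - a) (c + a))) := by
    intro x hx
    by_cases h0 : a ≤ x 0
    · by_cases h1 : a ≤ |x 1 - c|
      · exact Or.inl ⟨hx, h0, h1⟩
      · have := abs_le.1 (not_le.1 h1).le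
        exact Or.inr (Or.inr ⟨hx 0, by linarith, by linarith⟩)
    · exact Or.inr (Or.inl ⟨⟨(hx 0).1, (not_le.1 h0).le⟩, hx 1⟩)
  have hle := (measure_mono (μ := volume) hcover).trans ((measure_union_le _ _).trans
    (add_le_add_right (measure_union_le _ _) _))
  rw [volume_container hL.le, volume_rectangle, volume_rectangle, Real.volume_Icc, Real.volume_Icc,
    Real.volume_Icc, ← ENNReal.ofReal_mul (by linarith), ← ENNReal.ofReal_mul (by linarith),
    ← ENNReal.ofReal_add (by simp only [sub_zero]; positivity)
      (mul_nonneg (by linarith) (by linarith))] at hle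
  rw [show L ^ 2 * (1 - 3 * a / L) = L ^ 2 - ((a - 0) * (L - 0) + (L - 0) * (c + a - (c - a))) by
      field_simp; ring,
    ENNReal.ofReal_sub _ (by simp only [sub_zero]; nlinarith [mul_nonneg ha hL.le])]
  exact tsub_le_iff_right.2 hle

/-- By independence the probability is an `N`-th power, to which Bernoulli's inequality applies. -/
lemma le_configMeasure_goodConfigurations {L a : ℝ} {N : ℕ} (c : ℝ) (hL : 0 < L) (ha : 0 ≤ a)
    (haL : 3 * a ≤ L) :
    ENNReal.ofReal (1 - N * (3 * a / L)) ≤ configMeasure L N (goodConfigurations L c a N) := by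
  have hp : 3 * a / L ≤ 1 := (div_le_one hL).2 haL
  rw [configMeasure, Measure.smul_apply, smul_eq_mul,
    Measure.restrict_apply (measurableSet_goodConfigurations L c a N),
    inter_eq_left.2 (goodConfigurations_subset L c a N), goodConfigurations_eq_pi, volume_pi_pi,
    Finset.prod_const, Finset.card_univ, Fintype.card_fin]
  calc ENNReal.ofReal (1 - N * (3 * a / L))
      ≤ ENNReal.ofReal ((L ^ (2 * N))⁻¹ * (L ^ 2 * (1 - 3 * a / L)) ^ N) := by
        refine ENNReal.ofReal_le_ofReal ?_
        rw [mul_pow, ← pow_mul, inv_mul_cancel_left₀ (by positivity)]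
        have := one_add_mul_le_pow (a := -(3 * a / L)) (by linarith) N
        rw [← sub_eq_add_neg] at this
        linarith
    _ = ENNReal.ofReal ((L ^ (2 * N))⁻¹) * ENNReal.ofReal (L ^ 2 * (1 - 3 * a / L)) ^ N := by
        rw [ENNReal.ofReal_mul (by positivity), ENNReal.ofReal_pow]
        exact mul_nonneg (by positivity) (by linarith)
    _ ≤ _ := by gcongr; exact le_volume_goodPositions c hL ha

/-! ### Comparison of the length scales. -/

/-- The larger of the capillary length and the grain radius. -/
def smallScale (B R : ℝ) : ℝ := max (1 / Real.sqrt B) R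

section Scales

variable {ν L B R : ℝ} {N : ℕ}

lemma smallScale_pos (hB : 0 < B) : 0 < smallScale B R :=
  lt_max_of_lt_left (one_div_pos.2 (Real.sqrt_pos.2 hB))

lemma div_sqrt_le {c : ℝ} (hc : 0 ≤ c) : c / Real.sqrt B ≤ c * smallScale B R := by
  rw [div_eq_mul_one_div]
  exact mul_le_mul_of_nonneg_left (le_max_left _ _) hc

lemma le_smallScale : R ≤ smallScale B R := le_max_right _ _

/-- The number of grains is a positive integer. This bounds `L` from below, so that small `θ` makes
the small scale small, both absolutely and relative to `L`. -/
lemma one_le_mul_sq (hν : 0 < ν) (hL : 0 < L) (hN : (N : ℝ) = ν * L ^ 2) : 1 ≤ ν * L ^ 2 := by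
  have : 0 < (N : ℝ) := hN ▸ by positivity
  rw [← hN]
  exact_mod_cast this

lemma smallScale_le (hν : 0 < ν) (hL : 0 < L) (hB : 0 < B) (hN : (N : ℝ) = ν * L ^ 2) :
    smallScale B R ≤ ν * theta L B R * L := by
  have h1 := one_le_mul_sq hν hL hN
  have h2 := smallScale_pos (R := R) hB
  calc smallScale B R ≤ ν * L ^ 2 * smallScale B R := le_mul_of_one_le_left h2.le h1
    _ = ν * theta L B R * L := by rw [theta, smallScale]; ring

lemma grain_area_le (hν : 0 < ν) (hL : 0 < L) (hR : 0 < R) (hN : (N : ℝ) = ν * L ^ 2) :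
    N * (Real.pi * R ^ 2) ≤ Real.pi * (ν * theta L B R) * R * L := by
  rw [hN]
  have h1 : L * R ≤ theta L B R := mul_le_mul_of_nonneg_left (le_max_right _ _) hL.le
  have h2 : 0 ≤ Real.pi * ν * R * L := by have := Real.pi_pos; positivity
  nlinarith [mul_le_mul_of_nonneg_left h1 h2]

end Scales

/-! ### Interfaces in good configurations. -/

lemma abs_apply_le_norm (p : Plane) (i : Fin 2) : |p i| ≤ ‖p‖ := PiLp.norm_apply_le p i

/-- If no grain is close to the left wall or to the height `v₀ L`, then every interface consists of
one component, which stays in a layer comparable to the capillary length. -/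
lemma IsInterface.single_component {ν L B R v₀ α αw : ℝ} {N : ℕ} {ω : Fin N → Plane} {Γ : Chain N}
    (hΓ : IsInterface L B R v₀ α αw ω Γ) (hν : 0 < ν) (hv₀ : 0 ≤ v₀) (hL : 0 < L) (hB : 0 < B)
    (hR : 0 < R) (hN : (N : ℝ) = ν * L ^ 2) (hθ : ν * theta L B R ≤ 1 / 27)
    (hω : ω ∈ goodConfigurations L (v₀ * L) (9 * smallScale B R) N) :
    Γ.m = 0 ∧ |Γ.v₁ L * L - v₀ * L| ≤ R ∧
      ∀ s ∈ Icc 0 (Γ.len 0), |Γ.curve 0 s 1 - Γ.v₁ L * L| < 4 / Real.sqrt B := by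
  have hd := smallScale_pos (R := R) hB
  have hRd : R ≤ smallScale B R := le_smallScale
  have hpi := Real.pi_lt_d2
  have hpi0 := Real.pi_pos
  have hv : |Γ.v₁ L * L - v₀ * L| ≤ R := by
    have h1 := (abs_v₁_sub_le hL hR.le hv₀ hΓ).trans (grain_area_le (B := B) hν hL hR hN)
    have h2 : Real.pi * (ν * theta L B R) ≤ 1 := by nlinarith
    exact (le_of_mul_le_mul_right h1 hL).trans (mul_le_of_le_one_left hR.le h2)
  have hcap := hΓ.capillary 0
  by_cases hlayer : ∃ s ∈ Icc 0 (Γ.len 0), 4 / Real.sqrt B ≤ |Γ.curve 0 s 1 - Γ.v₁ L * L|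
  · exfalso
    obtain ⟨s, hs, hs4⟩ := hlayer
    -- The length bound with `D = 4` is `2π / √B`, and `2π < 7`.
    have hlen : Γ.len 0 ≤ 7 * smallScale B R := by
      have h1 := hcap.length_le hB le_rfl hs hs4
      have h2 : 8 * Real.pi / (4 * Real.sqrt B) = 2 * Real.pi / Real.sqrt B := by
        have := Real.sqrt_pos.2 hB
        field_simp
        ring
      have h3 := div_sqrt_le (B := B) (R := R) (c := 2 * Real.pi) (by positivity)
      nlinarith
    have hend : Γ.curve 0 (Γ.len 0) 0 ≤ 7 * smallScale B R := by
      have h1 := (abs_apply_le_norm _ 0).trans hcap.norm_sub_le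
      rw [PiLp.sub_apply, hΓ.start_wall, sub_zero] at h1
      linarith [le_abs_self (Γ.curve 0 (Γ.len 0) 0)]
    -- The right wall is at distance `L ≥ 27 d`, with `d` the small scale; a grain reached by the
    -- arc would have its centre within `7 d + R ≤ 8 d` of the left wall.
    rcases Nat.eq_zero_or_pos Γ.m with hm | hm
    · have hlast : Fin.last Γ.m = 0 := Fin.ext hm
      have h1 := hΓ.end_wall
      rw [hlast] at h1
      have h2 := smallScale_le (R := R) hν hL hB hN
      nlinarith
    · have hj : (⟨0, hm⟩ : Fin Γ.m).castSucc = 0 := Fin.ext rfl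
      have h1 := hΓ.arrive ⟨0, hm⟩
      rw [hj, mem_sphere_iff_norm] at h1
      have h2 := abs_apply_le_norm (Γ.curve 0 (Γ.len 0) - ω (Γ.grain ⟨0, hm⟩)) 0
      rw [h1, PiLp.sub_apply, abs_le] at h2
      have h3 := (hω (Γ.grain ⟨0, hm⟩)).2.1
      linarith
  · push Not at hlayer
    refine ⟨?_, hv, hlayer⟩
    by_contra hm0
    have hm := Nat.pos_of_ne_zero hm0
    have hj : (⟨0, hm⟩ : Fin Γ.m).castSucc = 0 := Fin.ext rfl
    have h1 := hΓ.arrive ⟨0, hm⟩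
    rw [hj, mem_sphere_iff_norm] at h1
    have h2 := abs_apply_le_norm (Γ.curve 0 (Γ.len 0) - ω (Γ.grain ⟨0, hm⟩)) 1
    rw [h1, PiLp.sub_apply] at h2
    have h3 := (hω (Γ.grain ⟨0, hm⟩)).2.2
    have h4 := hlayer _ hcap.length_mem
    have h5 := div_sqrt_le (B := B) (R := R) (c := 4) (by norm_num)
    rw [abs_le] at h2 hv
    rw [abs_lt] at h4
    -- The centre would be within `R + 4 / √B + R ≤ 6 d` of the height `v₀ L`.
    refine absurd h3 (not_le.2 (abs_lt.2 ⟨?_, ?_⟩)) <;> linarith [h2.1, h2.2]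

lemma Chain.carrier_of_m_eq_zero {N : ℕ} {Γ : Chain N} (hm : Γ.m = 0) :
    Γ.carrier = Γ.curve 0 '' Icc 0 (Γ.len 0) := by
  have h0 : ∀ i : Fin (Γ.m + 1), i = 0 := fun i => Fin.ext (by simp; omega)
  ext x
  simp only [Chain.carrier, mem_iUnion]
  exact ⟨fun ⟨i, hi⟩ => h0 i ▸ hi, fun h => ⟨0, h⟩⟩

/-- Used at the walls, with `S` the open parameter interval, on which the curve is known to stay
inside the container. -/
lemma HasDerivWithinAt.nonneg_of_slope_nonneg {f : ℝ → ℝ} {f' x : ℝ} {S : Set ℝ}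
    [(nhdsWithin x S).NeBot] (hf : HasDerivWithinAt f f' S x) (hx : x ∉ S)
    (h : ∀ y ∈ S, 0 ≤ slope f x y) : 0 ≤ f' :=
  ge_of_tendsto ((hasDerivWithinAt_iff_tendsto_slope' hx).1 hf)
    (Filter.eventually_of_mem self_mem_nhdsWithin h)

/-- Between walls with contact angle zero, an interface of one component is horizontal. -/
lemma IsInterface.carrier_eq {L B R v₀ α : ℝ} {N : ℕ} {ω : Fin N → Plane} {Γ : Chain N}
    (hΓ : IsInterface L B R v₀ α 0 ω Γ) (hB : 0 < B) (hm : Γ.m = 0) :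
    Γ.carrier = {x | x 0 ∈ Icc 0 L ∧ x 1 - Γ.v₁ L * L = 0} := by
  have hcap := hΓ.capillary 0
  have hlast : Fin.last Γ.m = 0 := Fin.ext hm
  have hℓ := hcap.length_pos
  have h0 : Γ.tangent 0 0 0 = 1 := by
    have hw : Γ.tangent 0 0 1 = 0 := by
      have hy := hΓ.young_start
      -- Both branches of Young's condition say that the tangent is horizontal; its direction comes
      -- from the curve entering the container.
      simp only [YoungCondition, wedge, Real.sin_zero, zero_sub, Real.sin_neg, Real.sin_pi,
        neg_zero] at hy
      rcases le_or_gt 0 (inner ℝ (!₂[1, 0] : Plane) (Γ.tangent 0 0)) with h | h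
      · simpa using hy.1 h
      · simpa using hy.2 h
    have hsq := hcap.tangent_sq hcap.zero_mem
    have hnn : 0 ≤ Γ.tangent 0 0 0 := by
      have : (nhdsWithin (0 : ℝ) (Ioo 0 (Γ.len 0))).NeBot := left_nhdsWithin_Ioo_neBot hℓ
      refine HasDerivWithinAt.nonneg_of_slope_nonneg
        ((hcap.hasDeriv_apply 0 hcap.zero_mem).mono Ioo_subset_Icc_self) (by simp) fun s hs => ?_
      have := ((hΓ.inside 0 s hs).1 0).1
      rw [slope_def_field, hΓ.start_wall]
      exact div_nonneg (by linarith) (by linarith [hs.1])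
    rw [hw] at hsq
    nlinarith
  have hl : Γ.tangent 0 (Γ.len 0) 0 = 1 := by
    have hend := hΓ.end_wall
    have hy := hΓ.young_end
    rw [hlast] at hend hy
    have hw : Γ.tangent 0 (Γ.len 0) 1 = 0 := by
      simp only [YoungCondition, wedge, Real.sin_zero, zero_sub, Real.sin_neg, Real.sin_pi,
        neg_zero] at hy
      rcases le_or_gt 0 (inner ℝ (!₂[-1, 0] : Plane) (Γ.tangent 0 (Γ.len 0))) with h | h
      · simpa using hy.1 h
      · simpa using hy.2 h
    have hsq := hcap.tangent_sq hcap.length_mem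
    have hnn : 0 ≤ Γ.tangent 0 (Γ.len 0) 0 := by
      have : (nhdsWithin (Γ.len 0) (Ioo 0 (Γ.len 0))).NeBot := right_nhdsWithin_Ioo_neBot hℓ
      refine HasDerivWithinAt.nonneg_of_slope_nonneg
        ((hcap.hasDeriv_apply 0 hcap.length_mem).mono Ioo_subset_Icc_self) (by simp)
        fun s hs => ?_
      have := ((hΓ.inside 0 s hs).1 0).2
      rw [slope_def_field, hend]
      exact div_nonneg_of_nonpos (by linarith) (by linarith [hs.2])
    rw [hw] at hsq
    nlinarith
  have hline : ∀ s ∈ Icc 0 (Γ.len 0), Γ.curve 0 s 1 = Γ.v₁ L * L ∧ Γ.curve 0 s 0 = s := by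
    intro s hs
    have h := hcap.eq_horizontal hB h0 hl hs
    rwa [hΓ.start_wall, zero_add] at h
  have hlen : Γ.len 0 = L := by
    have h := hΓ.end_wall
    rw [hlast] at h
    rw [← (hline _ hcap.length_mem).2, h]
  rw [Chain.carrier_of_m_eq_zero hm]
  ext x
  constructor
  · rintro ⟨s, hs, rfl⟩
    have h := hline s hs
    exact ⟨by rw [h.2, ← hlen]; exact hs, sub_eq_zero.2 h.1⟩
  · rintro ⟨hx0, hx1⟩
    rw [← hlen] at hx0
    have h := hline _ hx0
    refine ⟨x 0, hx0, ?_⟩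
    ext i
    fin_cases i
    · exact h.2
    · exact h.1.trans (sub_eq_zero.1 hx1).symm

/-! ### Existence of horizontal interfaces. -/

/-- The horizontal chain at height `lam` that meets no grain. -/
def horizontalChain (N : ℕ) (L lam : ℝ) : Chain N where
  m := 0
  grain := Fin.elim0
  len _ := L
  curve _ s := !₂[s, lam]
  tangent _ _ := !₂[1, 0]

section HorizontalChain

variable {N : ℕ} {L lam : ℝ}

lemma connectedCarrier_horizontalChain :
    (horizontalChain N L lam).connectedCarrier = {x | x 0 ∈ Icc 0 L ∧ x 1 = lam} := by
  have hcar : (horizontalChain N L lam).carrier = {x | x 0 ∈ Icc 0 L ∧ x 1 = lam} := by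
    rw [Chain.carrier_of_m_eq_zero rfl]
    ext x
    constructor
    · rintro ⟨s, hs, rfl⟩
      exact ⟨hs, rfl⟩
    · rintro ⟨h0, h1⟩
      refine ⟨x 0, h0, ?_⟩
      ext i
      fin_cases i
      · rfl
      · exact h1.symm
  rw [Chain.connectedCarrier, hcar, union_eq_left]
  exact iUnion_subset fun j => Fin.elim0 j

/-- A path to the bottom from height at least `lam` crosses the line by the intermediate value
theorem; from below the line, a vertical segment works. -/
lemma below_horizontalChain (hlam : lam ∈ Ioo 0 L) :
    (horizontalChain N L lam).below L = rectangle (Icc 0 L) (Ico 0 lam) := by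
  ext x
  simp only [Chain.below, connectedCarrier_horizontalChain, mem_ofPred_eq]
  constructor
  · rintro ⟨y, hy, hj⟩
    have hx := hj.source_mem.1
    refine ⟨hx 0, (hx 1).1, ?_⟩
    by_contra! hle
    obtain ⟨p, hp⟩ := hj
    have hc : Continuous fun s => p s 1 := by fun_prop
    obtain ⟨s, hs⟩ := mem_range_of_exists_le_of_exists_ge (c := lam) hc
      ⟨1, by rw [p.target, hy]; exact hlam.1.le⟩ ⟨0, by rw [p.source]; exact hle⟩
    exact (hp s).2 ⟨(hp s).1 0, hs⟩
  · rintro ⟨hx0, hx1⟩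
    refine ⟨!₂[x 0, 0], rfl, JoinedIn.of_segment_subset ?_⟩
    rintro z ⟨a, b, ha, hb, hab, rfl⟩
    have hz0 (x : Plane) : (a • x + b • (!₂[x 0, 0] : Plane)) 0 = x 0 := by
      simp only [PiLp.add_apply, PiLp.smul_apply, smul_eq_mul, Matrix.cons_val_zero]
      rw [← add_mul, hab, one_mul]
    have hz1 : (a • x + b • (!₂[x 0, 0] : Plane)) 1 = a * x 1 := by simp
    have hlt : a * x 1 < lam := by nlinarith [hx1.1, hx1.2]
    refine ⟨fun i => ?_, fun h => ?_⟩
    · fin_cases i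
      · exact (hz0 x).symm ▸ hx0
      · exact hz1.symm ▸ ⟨mul_nonneg ha hx1.1, hlt.le.trans hlam.2.le⟩
    · exact hlt.ne (hz1 ▸ h.2)

/-- The reference height is the height of the line itself, which makes zero curvature consistent
with the capillary equation. -/
lemma v₁_horizontalChain (hlam : lam ∈ Ioo 0 L) :
    (horizontalChain N L lam).v₁ L * L = lam := by
  have hL : 0 < L := hlam.1.trans hlam.2
  rw [Chain.v₁, below_horizontalChain hlam, volume_rectangle, Real.volume_Icc, Real.volume_Ico,
    sub_zero, sub_zero, ← ENNReal.ofReal_mul hL.le,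
    ENNReal.toReal_ofReal (mul_pos hL hlam.1).le]
  field_simp

/-- A horizontal line that avoids the grains and bounds the right amount of liquid is an
interface between walls with contact angle zero. -/
lemma isInterface_horizontalChain {B R v₀ α : ℝ} {ω : Fin N → Plane} (hlam : lam ∈ Ioo 0 L)
    (hω : ∀ k, R < |ω k 1 - lam|)
    (hvol : volume (rectangle (Icc 0 L) (Ico 0 lam) \ grains R ω) = ENNReal.ofReal (v₀ * L ^ 2)) :
    IsInterface L B R v₀ α 0 ω (horizontalChain N L lam) where
  capillary i := by
    rw [v₁_horizontalChain hlam]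
    refine ⟨hlam.1.trans hlam.2, fun s _ => ?_, fun s _ => ?_, fun s _ => ?_, ?_⟩
    · have hcurve : (horizontalChain N L lam).curve i =
          fun s : ℝ => s • (!₂[1, 0] : Plane) + !₂[0, lam] := by
        ext s i
        fin_cases i <;> simp [horizontalChain]
      rw [hcurve]
      refine ((((hasDerivAt_id s).smul_const _).add_const _).congr_deriv ?_).hasDerivWithinAt
      rw [one_smul]
      rfl
    · simp [horizontalChain, EuclideanSpace.norm_eq]
    · have : (B * ((horizontalChain N L lam).curve i s 1 - lam)) = 0 := by simp [horizontalChain]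
      rw [this, zero_smul]
      exact hasDerivWithinAt_const s _ _
    · intro s _ s' _ h
      exact congrArg (fun x : Plane => x 0) h
  inside i s hs := by
    refine ⟨fun i => ?_, fun h => ?_⟩
    · fin_cases i
      · exact hs
      · exact hlam
    · obtain ⟨k, hk⟩ := mem_iUnion.1 h
      rw [Metric.mem_closedBall, dist_eq_norm] at hk
      have h1 := (abs_apply_le_norm _ 1).trans hk
      rw [PiLp.sub_apply, abs_sub_comm] at h1
      exact (hω k).not_ge h1
  disjoint i i' h := by
    have h1 := i.2
    have h2 := i'.2
    have h3 : (horizontalChain N L lam).m = 0 := rfl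
    have h4 : (i : ℕ) < i' := h
    omega
  start_wall := rfl
  young_start := by simp [YoungCondition, wedge, horizontalChain]
  end_wall := rfl
  young_end := by simp [YoungCondition, wedge, horizontalChain]
  arrive j := Fin.elim0 j
  young_arrive j := Fin.elim0 j
  leave j := Fin.elim0 j
  young_leave j := Fin.elim0 j
  liquid_volume := by rw [below_horizontalChain hlam, hvol]

end HorizontalChain

/-- The liquid volume below a given height depends continuously on the height. -/
lemma continuous_volume_rectangle_diff {L : ℝ} (hL : 0 ≤ L) (G : Set Plane) :
    Continuous fun lam => (volume (rectangle (Icc 0 L) (Ico 0 lam) \ G)).toReal := by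
  have hfin : ∀ lam, volume (rectangle (Icc 0 L) (Ico 0 lam) \ G) ≠ ⊤ := fun lam =>
    ne_top_of_le_ne_top (by
      rw [volume_rectangle, Real.volume_Icc, Real.volume_Ico]
      exact ENNReal.mul_ne_top ENNReal.ofReal_ne_top ENNReal.ofReal_ne_top)
      (measure_mono sdiff_subset)
  refine (LipschitzWith.of_le_add_mul' L fun a b => ?_).continuous
  refine ENNReal.toReal_le_of_le_ofReal (by positivity) ?_
  rw [ENNReal.ofReal_add ENNReal.toReal_nonneg (by positivity), ENNReal.ofReal_toReal (hfin b)]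
  calc volume (rectangle (Icc 0 L) (Ico 0 a) \ G)
      ≤ volume ((rectangle (Icc 0 L) (Ico 0 b) \ G) ∪ rectangle (Icc 0 L) (Ico b a)) := by
        refine measure_mono fun x hx => ?_
        rcases lt_or_ge (x 1) b with h | h
        · exact Or.inl ⟨⟨hx.1.1, hx.1.2.1, h⟩, hx.2⟩
        · exact Or.inr ⟨hx.1.1, h, hx.1.2.2⟩
    _ ≤ volume (rectangle (Icc 0 L) (Ico 0 b) \ G) + volume (rectangle (Icc 0 L) (Ico b a)) :=
        measure_union_le _ _
    _ ≤ _ := by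
        rw [volume_rectangle, Real.volume_Icc, Real.volume_Ico, sub_zero, ← ENNReal.ofReal_mul hL]
        gcongr
        exact le_abs_self _

/-- If no grain is close to the height `v₀ L`, there is a horizontal interface. -/
lemma exists_isInterface {ν L B R v₀ α : ℝ} {N : ℕ} {ω : Fin N → Plane} (hν : 0 < ν)
    (hv₀ : 0 < v₀) (hL : 0 < L) (hB : 0 < B) (hR : 0 < R) (hN : (N : ℝ) = ν * L ^ 2)
    (hθ : ν * theta L B R ≤ 1 / 27) (hθ' : ν * theta L B R ≤ (1 - v₀) / 27)
    (hω : ω ∈ goodConfigurations L (v₀ * L) (9 * smallScale B R) N) :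
    ∃ Γ : Chain N, IsInterface L B R v₀ α 0 ω Γ := by
  have hd := smallScale_pos (R := R) hB
  have hRd : R ≤ smallScale B R := le_smallScale
  have hpi := Real.pi_lt_d2
  have hdL := smallScale_le (R := R) hν hL hB hN
  have hv0L : 0 < v₀ * L := mul_pos hv₀ hL
  have harea : N * (Real.pi * R ^ 2) ≤ R * L := by
    refine (grain_area_le (B := B) hν hL hR hN).trans ?_
    have h1 : Real.pi * (ν * theta L B R) ≤ 1 := by nlinarith [Real.pi_pos]
    nlinarith [mul_le_mul_of_nonneg_right h1 (mul_pos hR hL).le]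
  have hRL : v₀ * L + R < L := by nlinarith
  have hrect : ∀ lam,
      volume (rectangle (Icc 0 L) (Ico 0 lam)) = ENNReal.ofReal (L * lam) := by
    intro lam
    rw [volume_rectangle, Real.volume_Icc, Real.volume_Ico, sub_zero, sub_zero,
      ← ENNReal.ofReal_mul hL.le]
  have hlow : (volume (rectangle (Icc 0 L) (Ico 0 (v₀ * L)) \ grains R ω)).toReal ≤ v₀ * L ^ 2 := by
    refine ENNReal.toReal_le_of_le_ofReal (by positivity) ((measure_mono sdiff_subset).trans_eq ?_)
    rw [hrect]
    ring_nf
  have hfin : ∀ lam, volume (rectangle (Icc 0 L) (Ico 0 lam) \ grains R ω) ≠ ⊤ :=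
    fun lam => ne_top_of_le_ne_top (by rw [hrect]; exact ENNReal.ofReal_ne_top)
      (measure_mono sdiff_subset)
  -- Raising the line by `R` adds the area `R L`, which exceeds or equals the total area of the
  -- grains.
  have hhigh : v₀ * L ^ 2 ≤
      (volume (rectangle (Icc 0 L) (Ico 0 (v₀ * L + R)) \ grains R ω)).toReal := by
    rw [← ENNReal.ofReal_le_iff_le_toReal (hfin _)]
    refine le_trans ?_ (le_measure_sdiff)
    rw [hrect]
    refine le_trans ?_ (tsub_le_tsub_left (volume_grains_le hR.le ω) _)
    rw [← ENNReal.ofReal_sub _ (by positivity)]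
    refine ENNReal.ofReal_le_ofReal ?_
    nlinarith
  obtain ⟨lam, hlam, hvol⟩ := intermediate_value_Icc (by linarith)
    (continuous_volume_rectangle_diff hL.le (grains R ω)).continuousOn ⟨hlow, hhigh⟩
  refine ⟨horizontalChain N L lam, isInterface_horizontalChain
    ⟨by linarith [hlam.1], by linarith [hlam.2]⟩ (fun k => ?_) ?_⟩
  · have h1 := (hω k).2.2
    have h2 : |v₀ * L - lam| ≤ R := abs_le.2 ⟨by linarith [hlam.2], by linarith [hlam.1]⟩
    have h3 := abs_sub_le (ω k 1) lam (v₀ * L)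
    rw [abs_sub_comm lam] at h3
    linarith
  · rw [← hvol, ENNReal.ofReal_toReal (hfin _)]

/-! ### Uniform smallness of the offset and the main theorem. -/

/-- The term `L R²` is of first order in the small scale because `L R ≤ θ ≤ 1`. -/
lemma offsetBound_le {v₀ L B R K : ℝ} (hv₀ : v₀ ∈ Icc (0 : ℝ) 1) (hK : 0 ≤ K)
    (hL : 0 < L) (hB : 0 < B) (hR : 0 < R) (hθ : theta L B R ≤ 1) :
    offsetBound 4 K v₀ L B R ≤ (8 + 2 * K) * smallScale B R := by
  have hd := smallScale_pos (R := R) hB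
  have hRd : R ≤ smallScale B R := le_smallScale
  have h1 : max (2 * 4 / Real.sqrt B) (2 * R) ≤ 8 * smallScale B R := by
    refine max_le ?_ (by linarith)
    rw [show (2 * 4 : ℝ) = 8 by norm_num]
    exact div_sqrt_le (by norm_num)
  have h2 : L * R ≤ 1 := (mul_le_mul_of_nonneg_left (le_max_right _ _) hL.le).trans hθ
  have h3 : v₀ * (L * R * R) ≤ smallScale B R :=
    (mul_le_of_le_one_left (by positivity) hv₀.2).trans
      ((mul_le_of_le_one_left hR.le h2).trans hRd)
  rw [offsetBound]
  nlinarith [mul_le_mul_of_nonneg_left h3 hK]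

lemma smallScale_le_sqrt_mul {ν L B R : ℝ} {N : ℕ} (hν : 0 < ν) (hL : 0 < L) (hB : 0 < B)
    (hN : (N : ℝ) = ν * L ^ 2) : smallScale B R ≤ Real.sqrt ν * theta L B R := by
  have hd := smallScale_pos (R := R) hB
  have h1 : 1 ≤ Real.sqrt ν * L := by
    rw [← Real.sqrt_sq hL.le, ← Real.sqrt_mul hν.le, Real.one_le_sqrt]
    exact one_le_mul_sq hν hL hN
  calc smallScale B R ≤ Real.sqrt ν * L * smallScale B R := le_mul_of_one_le_left hd.le h1
    _ = _ := by rw [theta, smallScale]; ring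

/-- The arc joins the two grain boundaries and is short by `length_le`; each radius adds `R`. -/
lemma IsInterface.norm_center_sub_le {L B R v₀ α αw D : ℝ} {N : ℕ} {ω : Fin N → Plane}
    {Γ : Chain N} (hΓ : IsInterface L B R v₀ α αw ω Γ) (hB : 0 < B) (hD : 4 ≤ D)
    {j j' : Fin Γ.m} (hj : (j' : ℕ) = j + 1)
    (hs : ∃ s ∈ Icc 0 (Γ.len j.succ), D / Real.sqrt B ≤ |Γ.curve j.succ s 1 - Γ.v₁ L * L|) :
    ‖ω (Γ.grain j) - ω (Γ.grain j')‖ ≤ 8 * Real.pi / (D * Real.sqrt B) + 2 * R := by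
  obtain ⟨s, hs, hDs⟩ := hs
  have hcap := hΓ.capillary j.succ
  have hjj : j'.castSucc = j.succ := Fin.ext hj
  have h1 := hΓ.arrive j'
  have h2 := hΓ.leave j
  rw [hjj, mem_sphere_iff_norm] at h1
  rw [mem_sphere_iff_norm, norm_sub_rev] at h2
  have h3 := hcap.norm_sub_le.trans (hcap.length_le hB hD hs hDs)
  rw [norm_sub_rev] at h3
  calc ‖ω (Γ.grain j) - ω (Γ.grain j')‖
      = ‖(ω (Γ.grain j) - Γ.curve j.succ 0) +
          ((Γ.curve j.succ 0 - Γ.curve j.succ (Γ.len j.succ)) +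
          (Γ.curve j.succ (Γ.len j.succ) - ω (Γ.grain j')))‖ := by congr 1; abel
    _ ≤ R + (8 * Real.pi / (D * Real.sqrt B) + R) :=
        (norm_add_le _ _).trans (add_le_add h2.le
          ((norm_add_le _ _).trans (add_le_add h3 h1.le)))
    _ = _ := by ring

end PorousMedium
end

open PorousMedium in
theorem mainTheorem1 (ν v₀ α αw : ℝ) (hν : 0 < ν) (hv₀ : v₀ ∈ Set.Icc (0 : ℝ) 1)
    (hα : α ∈ Set.Icc (-(Real.pi / 2)) (Real.pi / 2))
    (hαw : αw ∈ Set.Icc (-(Real.pi / 2)) (Real.pi / 2)) :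
    ∃ D₀ > (0 : ℝ), ∃ K > (0 : ℝ),
      -- two consecutive grains joined by a component that leaves the layer of height `D / √B`
      -- are close to each other
      (∀ (N : ℕ) (L B R : ℝ), 0 < L → 0 < B → 0 < R → R < 1 / 2 → (N : ℝ) = ν * L ^ 2 →
        ∀ ω ∈ configurations L N, ∀ Γ : Chain N, IsInterface L B R v₀ α αw ω Γ →
        ∀ D ≥ D₀, ∀ j j' : Fin Γ.m, (j' : ℕ) = j + 1 →
          (∃ s ∈ Set.Icc 0 (Γ.len j.succ),
            D / Real.sqrt B ≤ |Γ.curve j.succ s 1 - Γ.v₁ L * L|) →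
          ‖ω (Γ.grain j) - ω (Γ.grain j')‖ ≤ K / (D * Real.sqrt B) + 2 * R) ∧
      -- the bound on the offset tends to zero as `θ → 0`
      (∀ η > (0 : ℝ), ∃ θ₀ > (0 : ℝ), ∀ (N : ℕ) (L B R : ℝ), 0 < L → 0 < B → 0 < R →
        R < 1 / 2 → (N : ℝ) = ν * L ^ 2 → theta L B R ≤ θ₀ →
        offsetBound D₀ K v₀ L B R ≤ η) ∧
      (∀ ε > (0 : ℝ), ∃ θε > (0 : ℝ), ∀ (N : ℕ) (L B R : ℝ), 0 < L → 0 < B → 0 < R →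
        R < 1 / 2 → (N : ℝ) = ν * L ^ 2 → theta L B R ≤ θε →
        ∃ Ωε ⊆ configurations L N, MeasurableSet Ωε ∧
          ENNReal.ofReal (1 - ε) ≤ configMeasure L N Ωε ∧
          ∀ ω ∈ Ωε,
            -- for arbitrary contact angles the interfaces stay in a thin horizontal strip
            (∀ Γ : Chain N, IsInterface L B R v₀ α αw ω Γ → ∀ x ∈ Γ.carrier,
              |x 1 - Γ.v₁ L * L| ≤ offsetBound D₀ K v₀ L B R ∧
              |x 1 - v₀ * L| ≤ offsetBound D₀ K v₀ L B R) ∧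
            -- for walls with contact angle zero they are horizontal lines
            (αw = 0 → ∃ h : ℝ, |h| ≤ offsetBound D₀ K v₀ L B R ∧
              ∀ Γ : Chain N, IsInterface L B R v₀ α αw ω Γ →
                Γ.carrier = {x | x 0 ∈ Set.Icc 0 L ∧ x 1 - Γ.v₁ L * L = h}) ∧
            -- and they exist
            (αw = 0 → 0 < v₀ → v₀ < 1 → ∃ Γ : Chain N, IsInterface L B R v₀ α αw ω Γ)) := by
  have hpi := Real.pi_pos
  refine ⟨4, by norm_num, 8 * Real.pi, by positivity, ?_, ?_, ?_⟩
  · intro N L B R _ hB _ _ _ ω _ Γ hΓ D hD j j' hj hs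
    exact hΓ.norm_center_sub_le hB hD hj hs
  · intro η hη
    have hsν := Real.sqrt_pos.2 hν
    refine ⟨min 1 (η / ((8 + 2 * (8 * Real.pi)) * Real.sqrt ν)), by positivity, ?_⟩
    intro N L B R hL hB hR _ hN hθ
    have h1 := hθ.trans (min_le_right _ _)
    rw [le_div_iff₀ (by positivity)] at h1
    refine (offsetBound_le hv₀ (by positivity) hL hB hR (hθ.trans (min_le_left _ _))).trans ?_
    refine (mul_le_mul_of_nonneg_left (smallScale_le_sqrt_mul (R := R) hν hL hB hN)
      (by positivity)).trans ?_
    linarith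
  · intro ε hε
    -- `c` leaves room for the line below the top wall; for `v₀ = 1` no existence is claimed and its
    -- value is arbitrary.
    obtain ⟨c, hc, hcv⟩ : ∃ c > (0 : ℝ), v₀ < 1 → c ≤ 1 - v₀ := by
      rcases lt_or_ge v₀ 1 with h | h
      · exact ⟨1 - v₀, by linarith, fun _ => le_rfl⟩
      · exact ⟨1, one_pos, fun h' => absurd h' h.not_gt⟩
    -- The failure probability is at most `27 ν θ`, where `27 = 3 * 9` comes from strips of total
    -- width `3 a` with `a = 9 d`.
    refine ⟨min 1 (min ε c) / (27 * ν), by positivity, ?_⟩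
    intro N L B R hL hB hR _ hN hθ
    rw [le_div_iff₀ (by positivity), le_min_iff, le_min_iff] at hθ
    obtain ⟨hθ1, hθε, hθc⟩ := hθ
    have hd := smallScale_pos (R := R) hB
    have hθ27 : ν * theta L B R ≤ 1 / 27 := by linarith
    have hoff : max (2 * 4 / Real.sqrt B) (2 * R) ≤ offsetBound 4 (8 * Real.pi) v₀ L B R := by
      have := hv₀.1
      exact le_add_of_nonneg_right (by positivity)
    have hoff4 : 8 / Real.sqrt B ≤ offsetBound 4 (8 * Real.pi) v₀ L B R :=
      (by norm_num : (8 : ℝ) / Real.sqrt B = 2 * 4 / Real.sqrt B).le.trans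
        ((le_max_left _ _).trans hoff)
    have hoffR : 2 * R ≤ offsetBound 4 (8 * Real.pi) v₀ L B R := (le_max_right _ _).trans hoff
    have h48 : 8 / Real.sqrt B = 2 * (4 / Real.sqrt B) := by ring
    refine ⟨goodConfigurations L (v₀ * L) (9 * smallScale B R) N,
      goodConfigurations_subset _ _ _ _, measurableSet_goodConfigurations _ _ _ _, ?_, ?_⟩
    · have hdL := smallScale_le (R := R) hν hL hB hN
      refine le_trans (ENNReal.ofReal_le_ofReal ?_)
        (le_configMeasure_goodConfigurations (v₀ * L) hL (by positivity) ?_)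
      · have : (N : ℝ) * (3 * (9 * smallScale B R) / L) = theta L B R * (27 * ν) := by
          rw [hN, theta, smallScale]
          field_simp
          ring
        linarith
      · nlinarith
    · intro ω hω
      -- The offset is `h = 0`: the line lies exactly at the reference height.
      refine ⟨fun Γ hΓ x hx => ?_, fun hαw0 => ⟨0, ?_, fun Γ hΓ => ?_⟩, fun hαw0 h0 h1 => ?_⟩
      · obtain ⟨hm, hv, hlayer⟩ := hΓ.single_component hν hv₀.1 hL hB hR hN hθ27 hω
        rw [Chain.carrier_of_m_eq_zero hm] at hx
        obtain ⟨s, hs, rfl⟩ := hx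
        have h1 := hlayer s hs
        have h2 := abs_sub_le (Γ.curve 0 s 1) (Γ.v₁ L * L) (v₀ * L)
        have h3 : 0 < 4 / Real.sqrt B := by positivity
        -- The distance to `v₀ L` is at most `4 / √B + R`, the mean of `8 / √B` and `2 R`, hence at
        -- most their maximum.
        constructor <;> linarith
      · rw [abs_zero]
        linarith
      · subst hαw0
        exact hΓ.carrier_eq hB (hΓ.single_component hν hv₀.1 hL hB hR hN hθ27 hω).1
      · subst hαw0
        exact exists_isInterface hν h0 hL hB hR hN hθ27 (by linarith [hcv h1]) hω
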